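/- Let $k\ge 2$ and $N\ge 2$ be integers, and let $d\sigma$ be the surface measure on the unit sphere $\mathbb{S}^{N-1}\subset\mathbb{R}^N$. For $u\in H^1(\mathbb{S}^{N-1})$ let \[ \lambda(u):=\inf\left\{\frac{\int_{\mathbb{S}^{N-1}}|\nabla\varphi|^2\,d\sigma}{\int_{\mathbb{S}^{N-1}}\varphi^2\,d\sigma}\ :\ \varphi\in H^1(\mathbb{S}^{N-1})\setminus\{0\},\ \ \sigma\big(\{\varphi\neq 0\}\cap\{u=0\}\big)=0\right\}, \] where $\nabla$ is the tangential gradient on the sphere, and $\lambda(u)=+\infty$ if $u=0$ almost everywhere. Let \[ \gamma(t):=\sqrt{\left(\tfrac{N-2}{2}\right)^2+t}-\tfrac{N-2}{2}\quad (t\in[0,+\infty)),\qquad \gamma(+\infty):=+\infty, \] and let \[ \alpha_{k,N}:=\inf\left\{\sum_{j=1}^k\gamma(\lambda(u_j))\ :\ u_1,\dots,u_k\in H^1(\mathbb{S}^{N-1}),\ \int_{\mathbb{S}^{N-1}}u_1^2\cdots u_k^2\,d\sigma=0\right\}. \] Then $0<\alpha_{k,N}\le 2$. -/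

import Mathlib

open MeasureTheory Filter Topology
open scoped ENNReal ContDiff

namespace OverlappingPartition

/-- The Euclidean space `ℝ^N`. -/
abbrev Euc (N : ℕ) : Type := EuclideanSpace ℝ (Fin N)

/-- The unit sphere `S^{N-1}` of `ℝ^N`. -/
abbrev Sph (N : ℕ) : Type := Metric.sphere (0 : Euc N) 1

/-- The surface measure of `S^{N-1}`, of total mass `N |B_1|`. -/
noncomputable abbrev sphMeasure (N : ℕ) : Measure (Sph N) :=
  (volume : Measure (Euc N)).toSphere

/-- The tangential gradient, at a point `x` of the sphere, of the restriction to the sphere of a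
function `F` on `ℝ^N`: the orthogonal projection of `∇F(x)` onto the tangent space `x^⊥`.
For smooth `F` it depends only on the restriction of `F` to the sphere, and it is the Riemannian
gradient of that restriction. -/
noncomputable def tangentialGradient {N : ℕ} (F : Euc N → ℝ) (x : Sph N) : Euc N :=
  gradient F (x : Euc N) - (inner ℝ (gradient F (x : Euc N)) (x : Euc N)) • (x : Euc N)

/-- `u ∈ H^1(S^{N-1})` with gradient `G`. Here `H^1(S^{N-1})` is the completion of the smooth
functions on the sphere (the restrictions of smooth functions on `ℝ^N`) for the norm
`(‖f‖_{L^2}^2 + ‖∇f‖_{L^2}^2)^{1/2}`: the pairs `(u, G)` are the elements of the closure in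
`L^2 × L^2` of the pairs `(f, ∇f)` with `f` smooth. By the divergence theorem on the sphere, `G` is
determined by `u` up to a null set. -/
structure HasSphGradient {N : ℕ} (u : Sph N → ℝ) (G : Sph N → Euc N) : Prop where
  memLp : MemLp u 2 (sphMeasure N)
  memLp_grad : MemLp G 2 (sphMeasure N)
  approx : ∃ F : ℕ → Euc N → ℝ, (∀ n, ContDiff ℝ ∞ (F n)) ∧
    Tendsto (fun n => eLpNorm (fun x : Sph N => F n (x : Euc N) - u x) 2 (sphMeasure N))
      atTop (𝓝 0) ∧
    Tendsto (fun n => eLpNorm (fun x : Sph N => tangentialGradient (F n) x - G x) 2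
      (sphMeasure N)) atTop (𝓝 0)

/-- `u ∈ H^1(S^{N-1})`. -/
def MemH1 {N : ℕ} (u : Sph N → ℝ) : Prop := ∃ G : Sph N → Euc N, HasSphGradient u G

/-- The optimal value `λ(u) ∈ [0, +∞]`: the infimum of `∫ |∇φ|^2 dσ / ∫ φ^2 dσ` over the
`φ ∈ H^1(S^{N-1})`, `φ ≠ 0`, such that `{φ ≠ 0} ∩ {u = 0}` is a null set.
If `u = 0` almost everywhere, there is no such `φ`, and `λ(u)` is an empty infimum, that is `+∞`. -/
noncomputable def lam {N : ℕ} (u : Sph N → ℝ) : ℝ≥0∞ :=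
  ⨅ (φ : Sph N → ℝ) (G : Sph N → Euc N) (_ : HasSphGradient φ G)
    (_ : ¬ φ =ᵐ[sphMeasure N] 0)
    (_ : sphMeasure N ({x | φ x ≠ 0} ∩ {x | u x = 0}) = 0),
    (∫⁻ x, ‖G x‖ₑ ^ 2 ∂(sphMeasure N)) / (∫⁻ x, ‖φ x‖ₑ ^ 2 ∂(sphMeasure N))

/-- `γ(t) = √(((N-2)/2)^2 + t) - (N-2)/2` for `t ∈ [0, +∞)`, and `γ(+∞) = +∞`. -/
noncomputable def gam (N : ℕ) (t : ℝ≥0∞) : ℝ≥0∞ :=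
  if t = ⊤ then ⊤
  else ENNReal.ofReal (Real.sqrt ((((N : ℝ) - 2) / 2) ^ 2 + t.toReal) - ((N : ℝ) - 2) / 2)

/-- The optimal value `α_{k,N}` of the overlapping partition problem. -/
noncomputable def alphaOpt (k N : ℕ) : ℝ≥0∞ :=
  ⨅ (u : Fin k → Sph N → ℝ) (_ : ∀ j, MemH1 (u j))
    (_ : ∫⁻ x, (∏ j, ‖u j x‖ₑ ^ 2) ∂(sphMeasure N) = 0),
    ∑ j, gam N (lam (u j))

end OverlappingPartition

/-! Positivity rests on an `L^1` Poincaré inequality on the sphere, with no compactness or spectral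
theory. Join X to Y in ℝ^N by the arc X_θ = cos θ X + sin θ Y, whose velocity is Y_θ = -sin θ X +
cos θ Y. Along it F(X_θ/|X_θ|) varies at speed at most |∇F| |Y_θ| / |X_θ|. Integrate over small X
and Y: since (X, Y) ↦ (X_θ, Y_θ) preserves Lebesgue measure on ℝ^N × ℝ^N, the bound no longer
depends on θ, and polar coordinates turn both sides into integrals over the sphere
(`exists_lintegral_enorm_sub_le`).

Applied to F², with Cauchy–Schwarz and Fatou, this gives ∬ |φ(y)² - φ(x)²| ≤ C ‖φ‖ ‖∇φ‖ for φ in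
H^1. If φ vanishes a.e. on Z = {u = 0}, keeping only x ∈ Z leaves σ(Z) ‖φ‖² ≤ C ‖φ‖ ‖∇φ‖, so σ(Z)² ≤
C² λ(u) (`exists_measure_sq_le_lam`). A vanishing product forces the k zero sets to cover the
sphere, so one of them has measure at least σ(S)/k; its λ, hence its γ, is bounded below.

For the upper bound, take the two positive parts of ±e·x and the constant 1 for the other indices.
Testing each positive part with itself gives λ ≤ N - 1, and γ(N - 1) = 1, while γ(λ(1)) = γ(0) = 0
(`alphaOpt_le_two`). -/

namespace OverlappingPartition

/-! ### Polar coordinates and rotations of pairs of vectors -/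

/-- Integration in polar coordinates of a product of an angular and a radial function. -/
theorem lintegral_polar {N : ℕ} (hN : 0 < N) {H : Euc N → ℝ≥0∞} (hH : Measurable H)
    {ψ : ℝ → ℝ≥0∞} (hψ : Measurable ψ) :
    ∫⁻ X : Euc N, H (‖X‖⁻¹ • X) * ψ ‖X‖ =
      (∫⁻ x, H x ∂(sphMeasure N)) * ∫⁻ r in Set.Ioi (0 : ℝ), ψ r * ENNReal.ofReal (r ^ (N - 1)) := by
  have : Nonempty (Fin N) := ⟨⟨0, hN⟩⟩
  have h := (volume : Measure (Euc N)).measurePreserving_homeomorphUnitSphereProd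
  have hm : Measurable fun p : Sph N × Set.Ioi (0 : ℝ) => H p.1 * ψ p.2 := by fun_prop
  have h1 := h.lintegral_comp hm
  rw [lintegral_prod_mul (f := fun x : Sph N => H x) (g := fun r : Set.Ioi (0 : ℝ) => ψ r)
    (by fun_prop) (by fun_prop)] at h1
  rw [← restrict_compl_singleton (μ := (volume : Measure (Euc N))) 0,
    ← lintegral_subtype_comap (measurableSet_singleton _).compl]
  simp only [homeomorphUnitSphereProd_apply_snd_coe, homeomorphUnitSphereProd_apply_fst_coe] at h1
  rw [h1, Measure.volumeIoiPow, lintegral_withDensity_eq_lintegral_mul _ (by fun_prop) (by fun_prop),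
    ← lintegral_subtype_comap measurableSet_Ioi]
  simp [mul_comm]

/-- A linear map scales volume by a constant factor, and this one maps a set of finite positive
volume onto itself, so the factor is 1. -/
theorem measurePreserving_rotation {E : Type*} [NormedAddCommGroup E] [InnerProductSpace ℝ E]
    [FiniteDimensional ℝ E] [MeasurableSpace E] [BorelSpace E] (θ : ℝ) :
    MeasurePreserving (ContinuousLinearMap.rotation (E := E) θ) volume volume := by
  set R := ContinuousLinearMap.rotation (E := E) θ
  -- The Euclidean unit ball, written out because the norm of `E × E` is the sup norm, whose ball is
  -- not invariant.
  let K : Set (E × E) := {p | ‖p.1‖ ^ 2 + ‖p.2‖ ^ 2 < 1}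
  have hK : R ⁻¹' K = K := by
    ext ⟨x, y⟩
    simp only [K, R, Set.mem_preimage, Set.mem_ofPred_eq, ContinuousLinearMap.rotation_apply]
    rw [@norm_add_sq_real, @norm_add_sq_real]
    simp only [norm_smul, inner_smul_left, inner_smul_right, Real.norm_eq_abs, abs_neg,
      mul_pow, sq_abs, RCLike.conj_to_real]
    rw [iff_iff_eq]
    congr 1
    linear_combination (‖x‖ ^ 2 + ‖y‖ ^ 2) * Real.sin_sq_add_cos_sq θ
  have hdet : LinearMap.det (R : E × E →ₗ[ℝ] E × E) ≠ 0 := by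
    have : (ContinuousLinearMap.rotation (E := E) (-θ) : E × E →ₗ[ℝ] E × E) ∘ₗ
        (R : E × E →ₗ[ℝ] E × E) = LinearMap.id := by
      refine LinearMap.ext fun ⟨x, y⟩ => ?_
      have h := Real.sin_sq_add_cos_sq θ
      simp only [R, LinearMap.comp_apply, ContinuousLinearMap.coe_coe,
        ContinuousLinearMap.rotation_apply, Real.cos_neg, Real.sin_neg, LinearMap.id_apply]
      refine Prod.ext ?_ ?_
      · simp only
        linear_combination (norm := module) h • x
      · simp only
        linear_combination (norm := module) h • y
    have h2 := congrArg LinearMap.det this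
    rw [LinearMap.det_comp, LinearMap.det_id] at h2
    exact right_ne_zero_of_mul_eq_one h2
  have key (s : Set (E × E)) : volume (⇑(R : E × E →ₗ[ℝ] E × E) ⁻¹' s) =
      ENNReal.ofReal |(LinearMap.det (R : E × E →ₗ[ℝ] E × E))⁻¹| * volume s :=
    Measure.addHaar_preimage_linearMap ((volume : Measure E).prod volume) hdet s
  have hKo : IsOpen K := isOpen_lt (by fun_prop) continuous_const
  have hK0 : volume K ≠ 0 := (hKo.measure_pos _ ⟨0, by simp [K]⟩).ne'
  have hKt : volume K ≠ ⊤ := by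
    refine ((Metric.isBounded_closedBall (x := (0 : E × E)) (r := 1)).subset ?_).measure_lt_top.ne
    rintro ⟨x, y⟩ h
    simp only [K, Set.mem_ofPred_eq] at h
    simp only [mem_closedBall_zero_iff, Prod.norm_def, sup_le_iff]
    constructor <;> nlinarith [sq_nonneg ‖x‖, sq_nonneg ‖y‖, norm_nonneg x, norm_nonneg y]
  have h1 := key K
  rw [show (⇑(R : E × E →ₗ[ℝ] E × E)) ⁻¹' K = K from hK] at h1
  have h3 : ENNReal.ofReal |(LinearMap.det (R : E × E →ₗ[ℝ] E × E))⁻¹| = 1 := by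
    have : 1 * volume K = ENNReal.ofReal |(LinearMap.det (R : E × E →ₗ[ℝ] E × E))⁻¹| * volume K := by
      rw [one_mul]; exact h1
    exact ((ENNReal.mul_left_inj hK0 hKt).1 this).symm
  refine ⟨R.continuous.measurable, Measure.ext fun s hs => ?_⟩
  rw [Measure.map_apply R.continuous.measurable hs]
  have := key s
  rwa [h3, one_mul] at this

/-! ### Tangential gradients along arcs -/

/-- The formula for `tangentialGradient`, at an arbitrary vector. -/
noncomputable def tangentPart {N : ℕ} (F : Euc N → ℝ) (v : Euc N) : Euc N :=
  gradient F v - (inner ℝ (gradient F v) v) • v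

theorem continuous_gradient {N : ℕ} {F : Euc N → ℝ} (hF : ContDiff ℝ ∞ F) :
    Continuous (gradient F) := by
  unfold gradient
  exact (LinearIsometryEquiv.continuous _).comp (hF.continuous_fderiv (by simp))

theorem continuous_tangentPart {N : ℕ} {F : Euc N → ℝ} (hF : ContDiff ℝ ∞ F) :
    Continuous (tangentPart F) := by
  have := continuous_gradient hF
  unfold tangentPart
  fun_prop

/-- Normalizing projects the velocity onto the tangent space and divides it by the norm;
self-adjointness moves the projection onto the gradient. -/
theorem hasDerivAt_comp_normalize {N : ℕ} {F : Euc N → ℝ} (hF : ContDiff ℝ ∞ F)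
    {c : ℝ → Euc N} {c' : Euc N} {θ : ℝ} (hc : HasDerivAt c c' θ) (h0 : c θ ≠ 0) :
    HasDerivAt (fun t => F (‖c t‖⁻¹ • c t))
      (‖c θ‖⁻¹ * inner ℝ (tangentPart F (‖c θ‖⁻¹ • c θ)) c') θ := by
  have hr : ‖c θ‖ ≠ 0 := norm_ne_zero_iff.2 h0
  have hn : HasDerivAt (fun t => ‖c t‖) (inner ℝ (c θ) c' / ‖c θ‖) θ := by
    have h1 := (hc.norm_sq).sqrt (by positivity)
    simp only [Real.sqrt_sq (norm_nonneg _)] at h1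
    convert h1 using 1
    field_simp
  have hp := (hn.inv hr).smul hc
  have hg : HasFDerivAt F (InnerProductSpace.toDual ℝ _ (gradient F (‖c θ‖⁻¹ • c θ)))
      (‖c θ‖⁻¹ • c θ) :=
    ((hF.differentiable (by simp)) _).hasGradientAt.hasFDerivAt
  have := hg.comp_hasDerivAt θ hp
  refine this.congr_deriv ?_
  simp only [tangentPart, inner_sub_left, inner_smul_left, inner_smul_right, inner_add_right,
    InnerProductSpace.toDual_apply_apply, RCLike.conj_to_real, Pi.inv_apply]
  field_simp
  ring

/-- Variation of a zero-homogeneous function along an arc of ellipse. -/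
theorem enorm_sub_le_lintegral_arc {N : ℕ} {F : Euc N → ℝ} (hF : ContDiff ℝ ∞ F)
    {X Y : Euc N} (h0 : ∀ θ : ℝ, Real.cos θ • X + Real.sin θ • Y ≠ 0) :
    ‖F (‖Y‖⁻¹ • Y) - F (‖X‖⁻¹ • X)‖ₑ ≤ ∫⁻ θ in Set.Icc 0 (Real.pi / 2),
      (fun p : Euc N × Euc N => ‖tangentPart F (‖p.1‖⁻¹ • p.1)‖ₑ * ‖p.1‖ₑ⁻¹ * ‖p.2‖ₑ)
        (ContinuousLinearMap.rotation θ (X, Y)) := by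
  set c : ℝ → Euc N := fun θ => Real.cos θ • X + Real.sin θ • Y with hc
  have hcd : ContDiff ℝ 1 c := by
    have h1 : ContDiff ℝ 1 Real.cos := Real.contDiff_cos
    have h2 : ContDiff ℝ 1 Real.sin := Real.contDiff_sin
    fun_prop
  have hd : ∀ θ, HasDerivAt c (-Real.sin θ • X + Real.cos θ • Y) θ := fun θ =>
    ((Real.hasDerivAt_cos θ).smul_const X).add ((Real.hasDerivAt_sin θ).smul_const Y)
  have hf : ContDiff ℝ 1 fun θ => F (‖c θ‖⁻¹ • c θ) := by
    have hn : ContDiff ℝ 1 fun θ => ‖c θ‖⁻¹ :=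
      (hcd.norm ℝ h0).inv fun θ => norm_ne_zero_iff.2 (h0 θ)
    exact (hF.of_le (by simp)).comp (hn.smul hcd)
  have h1 := enorm_sub_le_lintegral_deriv_of_contDiffOn_Icc (a := 0) (b := Real.pi / 2)
    hf.contDiffOn (by positivity)
  have e0 : c 0 = X := by simp [hc]
  have e1 : c (Real.pi / 2) = Y := by simp [hc]
  simp only [e0, e1] at h1
  -- The second component of the rotated pair is the velocity of the first, so Cauchy–Schwarz bounds
  -- the derivative by the integrand.
  refine h1.trans (lintegral_mono fun θ => ?_)
  rw [(hasDerivAt_comp_normalize hF (hd θ) (h0 θ)).deriv]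
  simp only [ContinuousLinearMap.rotation_apply]
  rw [enorm_mul, enorm_inv (norm_ne_zero_iff.2 (h0 θ)), enorm_norm, mul_right_comm, mul_comm]
  gcongr
  rw [← ofReal_norm, ← ofReal_norm, ← ofReal_norm, ← ENNReal.ofReal_mul (norm_nonneg _)]
  exact ENNReal.ofReal_le_ofReal (norm_inner_le_norm _ _)

/-- If X ≠ 0, an arc through the origin puts Y on the line spanned by X, which is a null set because
N ≥ 2. -/
theorem ae_ae_arc_ne_zero {N : ℕ} (hN : 2 ≤ N) :
    ∀ᵐ X : Euc N, ∀ᵐ Y : Euc N, ∀ θ : ℝ, Real.cos θ • X + Real.sin θ • Y ≠ 0 := by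
  have : Nontrivial (Euc N) := by
    have : Nonempty (Fin N) := ⟨⟨0, by omega⟩⟩
    infer_instance
  filter_upwards [Measure.ae_ne volume (0 : Euc N)] with X hX
  have hs : (Submodule.span ℝ {X}) ≠ ⊤ := by
    intro h
    have h1 := finrank_span_singleton (K := ℝ) hX
    rw [h, finrank_top, finrank_euclideanSpace_fin] at h1
    omega
  have h0 := Measure.addHaar_submodule (volume : Measure (Euc N)) _ hs
  filter_upwards [measure_eq_zero_iff_ae_notMem.1 h0] with Y hY θ h
  by_cases hsin : Real.sin θ = 0
  · have hc : Real.cos θ ≠ 0 := by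
      intro hc
      have := Real.sin_sq_add_cos_sq θ
      simp [hsin, hc] at this
    simp [hsin, hc, hX] at h
  · apply hY
    rw [SetLike.mem_coe, Submodule.mem_span_singleton]
    refine ⟨-((Real.sin θ)⁻¹ * Real.cos θ), ?_⟩
    have h2 : Y = (Real.sin θ)⁻¹ • (Real.sin θ • Y) := by
      rw [smul_smul, inv_mul_cancel₀ hsin, one_smul]
    rw [h2, eq_neg_of_add_eq_zero_right h]
    module

/-- The radial factor of a polar integral can be cancelled once it is known to be neither 0 nor
infinite. -/
theorem lintegral_radial_indicator (n : ℕ) :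
    ∫⁻ r in Set.Ioi (0 : ℝ), (Set.Iio (1 / 2 : ℝ)).indicator 1 r * ENNReal.ofReal (r ^ n) ≠ 0 ∧
    ∫⁻ r in Set.Ioi (0 : ℝ), (Set.Iio (1 / 2 : ℝ)).indicator 1 r * ENNReal.ofReal (r ^ n) ≠ ⊤ := by
  let ψ : ℝ → ℝ≥0∞ := (Set.Iio (1 / 2 : ℝ)).indicator 1
  let χ : ℝ → ℝ≥0∞ := (Set.Iio (1 : ℝ)).indicator 1
  have hψ : Measurable ψ := measurable_one.indicator measurableSet_Iio
  have hχ : Measurable χ := measurable_one.indicator measurableSet_Iio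
  change ∫⁻ r in Set.Ioi (0 : ℝ), ψ r * ENNReal.ofReal (r ^ n) ≠ 0 ∧
    ∫⁻ r in Set.Ioi (0 : ℝ), ψ r * ENNReal.ofReal (r ^ n) ≠ ⊤
  have hIoo : ∫⁻ r in Set.Ioi (0 : ℝ), χ r = 1 := by
    rw [lintegral_indicator_one measurableSet_Iio, Measure.restrict_apply measurableSet_Iio,
      Set.inter_comm, Set.Ioi_inter_Iio]
    simp
  constructor
  · intro h
    rw [lintegral_eq_zero_iff (by fun_prop), Filter.EventuallyEq,
      ae_restrict_iff' measurableSet_Ioi] at h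
    have h2 : volume (Set.Ioo (0 : ℝ) (1 / 2)) = 0 := by
      refine measure_mono_null (fun r hr => ?_) h
      simp only [Set.mem_compl_iff, Set.mem_ofPred_eq, Set.mem_Ioi, Pi.zero_apply, not_forall]
      refine ⟨hr.1, ?_⟩
      have : ψ r = 1 := Set.indicator_of_mem (Set.mem_Iio.2 hr.2) _
      rw [this, one_mul]
      exact (ENNReal.ofReal_pos.2 (pow_pos hr.1 _)).ne'
    simp at h2
  · refine ne_top_of_le_ne_top ENNReal.one_ne_top (le_trans ?_ hIoo.le)
    refine setLIntegral_mono hχ fun r hr => ?_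
    by_cases h : r < 1 / 2
    · have h1 : ψ r = 1 := Set.indicator_of_mem (Set.mem_Iio.2 h) _
      have h2 : χ r = 1 := Set.indicator_of_mem (Set.mem_Iio.2 (by linarith)) _
      rw [h1, h2, one_mul]
      exact ENNReal.ofReal_le_one.2 (pow_le_one₀ (le_of_lt hr) (by linarith))
    · have h1 : ψ r = 0 := Set.indicator_of_notMem (by simpa using h) _
      simp [h1]

/-! ### The Poincaré inequality for smooth functions -/

/-- The `L^1` Poincaré inequality on the sphere. -/
theorem exists_lintegral_enorm_sub_le {N : ℕ} (hN : 2 ≤ N) :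
    ∃ C : ℝ≥0∞, C ≠ ⊤ ∧ ∀ F : Euc N → ℝ, ContDiff ℝ ∞ F →
      ∫⁻ x, ∫⁻ y, ‖F (y : Euc N) - F (x : Euc N)‖ₑ ∂(sphMeasure N) ∂(sphMeasure N) ≤
        C * ∫⁻ x, ‖tangentPart F (x : Euc N)‖ₑ ∂(sphMeasure N) := by
  have hN0 : 0 < N := by omega
  -- The endpoints are taken in the ball of radius 1/2 (`ψ`), so that X_θ and Y_θ stay in the unit
  -- ball (`χ`); `ρ` carries the factor 1/|X_θ|.
  let ψ : ℝ → ℝ≥0∞ := (Set.Iio (1 / 2 : ℝ)).indicator 1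
  let χ : ℝ → ℝ≥0∞ := (Set.Iio (1 : ℝ)).indicator 1
  let ρ : ℝ → ℝ≥0∞ := fun r => χ r * ‖r‖ₑ⁻¹
  have hψ : Measurable ψ := measurable_one.indicator measurableSet_Iio
  have hχ : Measurable χ := measurable_one.indicator measurableSet_Iio
  have hρ : Measurable ρ := by fun_prop
  set a := ∫⁻ r in Set.Ioi (0 : ℝ), ψ r * ENNReal.ofReal (r ^ (N - 1))
  set b := ∫⁻ r in Set.Ioi (0 : ℝ), ρ r * ENNReal.ofReal (r ^ (N - 1))
  have hIoo : ∫⁻ r in Set.Ioi (0 : ℝ), χ r = 1 := by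
    rw [lintegral_indicator_one measurableSet_Iio, Measure.restrict_apply measurableSet_Iio,
      Set.inter_comm, Set.Ioi_inter_Iio]
    simp
  obtain ⟨ha0, hat⟩ : a ≠ 0 ∧ a ≠ ⊤ := lintegral_radial_indicator (N - 1)
  -- The singularity 1/r is absorbed by r^(N-1), again because N ≥ 2.
  have hbt : b ≠ ⊤ := by
    refine ne_top_of_le_ne_top ENNReal.one_ne_top (le_trans ?_ hIoo.le)
    refine setLIntegral_mono hχ fun r hr => ?_
    have hr0 : 0 < r := hr
    by_cases h : r < 1
    · have h2 : χ r = 1 := Set.indicator_of_mem (Set.mem_Iio.2 h) _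
      simp only [ρ, h2, one_mul]
      obtain ⟨m, rfl⟩ : ∃ m, N = m + 2 := ⟨N - 2, by omega⟩
      rw [show m + 2 - 1 = m + 1 by omega, pow_succ', ENNReal.ofReal_mul hr0.le,
        Real.enorm_of_nonneg hr0.le, ← mul_assoc, ENNReal.inv_mul_cancel
        (ENNReal.ofReal_pos.2 hr0).ne' ENNReal.ofReal_ne_top, one_mul]
      exact ENNReal.ofReal_le_one.2 (pow_le_one₀ hr0.le h.le)
    · have h1 : χ r = 0 := Set.indicator_of_notMem (by simpa using h) _
      simp [h1, ρ]
  set c := ∫⁻ Y : Euc N, χ ‖Y‖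
  have hct : c ≠ ⊤ := by
    have : c = volume (Metric.ball (0 : Euc N) 1) := by
      rw [← lintegral_indicator_one Metric.isOpen_ball.measurableSet]
      refine lintegral_congr fun Y => ?_
      by_cases h : ‖Y‖ < 1 <;> simp [χ, h]
    rw [this]
    exact measure_ball_lt_top.ne
  refine ⟨(a * a)⁻¹ * (volume (Set.Icc 0 (Real.pi / 2)) * (b * c)), ?_, fun F hF => ?_⟩
  · refine ENNReal.mul_ne_top (ENNReal.inv_ne_top.2 (mul_ne_zero ha0 ha0)) ?_
    refine ENNReal.mul_ne_top ?_ (ENNReal.mul_ne_top hbt hct)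
    simp
  have hFm : Measurable F := hF.continuous.measurable
  have hTm : Measurable fun v => ‖tangentPart F v‖ₑ :=
    (continuous_tangentPart hF).enorm.measurable
  let W : Euc N × Euc N → ℝ≥0∞ := fun p =>
    ‖tangentPart F (‖p.1‖⁻¹ • p.1)‖ₑ * ρ ‖p.1‖ * χ ‖p.2‖
  have hWm : Measurable W := by
    have : Measurable fun p : Euc N × Euc N => ‖tangentPart F (‖p.1‖⁻¹ • p.1)‖ₑ :=
      hTm.comp (by fun_prop)
    fun_prop
  have hW : ∫⁻ p, W p = (∫⁻ x, ‖tangentPart F (x : Euc N)‖ₑ ∂(sphMeasure N)) * (b * c) := by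
    rw [Measure.volume_eq_prod]
    have h1 : Measurable fun X : Euc N => ‖tangentPart F (‖X‖⁻¹ • X)‖ₑ * ρ ‖X‖ :=
      (hTm.comp (by fun_prop)).mul (by fun_prop)
    simp only [W]
    rw [lintegral_prod_mul (f := fun X : Euc N => ‖tangentPart F (‖X‖⁻¹ • X)‖ₑ * ρ ‖X‖)
      (g := fun Y : Euc N => χ ‖Y‖) h1.aemeasurable (by fun_prop), lintegral_polar hN0 hTm hρ,
      mul_assoc]
  have hL : ∫⁻ X : Euc N, (∫⁻ Y : Euc N, ‖F (‖Y‖⁻¹ • Y) - F (‖X‖⁻¹ • X)‖ₑ * ψ ‖Y‖) * ψ ‖X‖ =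
      (∫⁻ x, ∫⁻ y, ‖F (y : Euc N) - F (x : Euc N)‖ₑ ∂(sphMeasure N) ∂(sphMeasure N)) *
        (a * a) := by
    have h1 : ∀ X : Euc N, ∫⁻ Y : Euc N, ‖F (‖Y‖⁻¹ • Y) - F (‖X‖⁻¹ • X)‖ₑ * ψ ‖Y‖ =
        (∫⁻ y, ‖F (y : Euc N) - F (‖X‖⁻¹ • X)‖ₑ ∂(sphMeasure N)) * a := fun X =>
      lintegral_polar hN0 (H := fun v => ‖F v - F (‖X‖⁻¹ • X)‖ₑ) (by fun_prop) hψ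
    have h2 : Measurable fun v : Euc N => ∫⁻ y, ‖F (y : Euc N) - F v‖ₑ ∂(sphMeasure N) :=
      Measurable.lintegral_prod_right' (f := fun p : Euc N × Sph N => ‖F p.2 - F p.1‖ₑ)
        (by fun_prop)
    simp only [h1]
    rw [lintegral_polar hN0 (H := fun v => (∫⁻ y, ‖F (y : Euc N) - F v‖ₑ ∂(sphMeasure N)) * a)
      (h2.mul_const a) hψ, lintegral_mul_const' a _ hat, mul_assoc]
  have hrot : Measurable fun q : (Euc N × Euc N) × ℝ =>
      W (ContinuousLinearMap.rotation q.2 q.1) := by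
    refine hWm.comp ?_
    simp only [ContinuousLinearMap.rotation_apply]
    fun_prop
  have hLW : ∫⁻ X : Euc N, (∫⁻ Y : Euc N, ‖F (‖Y‖⁻¹ • Y) - F (‖X‖⁻¹ • X)‖ₑ * ψ ‖Y‖) * ψ ‖X‖ ≤
      ∫⁻ X : Euc N, ∫⁻ Y : Euc N, ∫⁻ θ in Set.Icc 0 (Real.pi / 2),
        W (ContinuousLinearMap.rotation θ (X, Y)) := by
    refine lintegral_mono_ae ?_
    filter_upwards [ae_ae_arc_ne_zero hN] with X hX
    rw [← lintegral_mul_const'' _ (by fun_prop)]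
    refine lintegral_mono_ae ?_
    filter_upwards [hX] with Y hY
    by_cases hX1 : ‖X‖ < 1 / 2
    swap
    · have : ψ ‖X‖ = 0 := Set.indicator_of_notMem (by simpa using hX1) _
      simp [this]
    by_cases hY1 : ‖Y‖ < 1 / 2
    swap
    · have : ψ ‖Y‖ = 0 := Set.indicator_of_notMem (by simpa using hY1) _
      simp [this]
    have e1 : ψ ‖X‖ = 1 := Set.indicator_of_mem (Set.mem_Iio.2 hX1) _
    have e2 : ψ ‖Y‖ = 1 := Set.indicator_of_mem (Set.mem_Iio.2 hY1) _
    rw [e1, e2, mul_one, mul_one]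
    refine (enorm_sub_le_lintegral_arc hF hY).trans (lintegral_mono fun θ => ?_)
    have hn : ∀ s t : ℝ, |s| ≤ 1 → |t| ≤ 1 → ‖s • X + t • Y‖ < 1 := fun s t hs ht => by
      refine (norm_add_le _ _).trans_lt ?_
      rw [norm_smul, norm_smul, Real.norm_eq_abs, Real.norm_eq_abs]
      nlinarith [norm_nonneg X, norm_nonneg Y]
    have n1 : ‖(ContinuousLinearMap.rotation θ (X, Y)).1‖ < 1 :=
      hn _ _ (Real.abs_cos_le_one _) (Real.abs_sin_le_one _)
    have n2 : ‖(ContinuousLinearMap.rotation θ (X, Y)).2‖ < 1 :=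
      hn _ _ (by rw [abs_neg]; exact Real.abs_sin_le_one _) (Real.abs_cos_le_one _)
    have c1 : χ ‖(ContinuousLinearMap.rotation θ (X, Y)).1‖ = 1 :=
      Set.indicator_of_mem (Set.mem_Iio.2 n1) _
    have c2 : χ ‖(ContinuousLinearMap.rotation θ (X, Y)).2‖ = 1 :=
      Set.indicator_of_mem (Set.mem_Iio.2 n2) _
    simp only [W, ρ, c1, c2, one_mul, enorm_norm]
    gcongr
    rw [← ofReal_norm]
    exact ENNReal.ofReal_le_one.2 n2.le
  have hWθ : ∫⁻ X : Euc N, ∫⁻ Y : Euc N, ∫⁻ θ in Set.Icc 0 (Real.pi / 2),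
        W (ContinuousLinearMap.rotation θ (X, Y)) =
      volume (Set.Icc 0 (Real.pi / 2)) * ∫⁻ p, W p := by
    have h1 : Measurable fun p : Euc N × Euc N => ∫⁻ θ in Set.Icc 0 (Real.pi / 2),
        W (ContinuousLinearMap.rotation θ p) := hrot.lintegral_prod_right'
    rw [← lintegral_prod (fun p : Euc N × Euc N => ∫⁻ θ in Set.Icc 0 (Real.pi / 2),
        W (ContinuousLinearMap.rotation θ p)) h1.aemeasurable, ← Measure.volume_eq_prod,
      lintegral_lintegral_swap hrot.aemeasurable]
    -- After Fubini, invariance under rotation makes the integral over (X, Y) the same for every θ.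
    simp only [(measurePreserving_rotation _).lintegral_comp hWm]
    rw [setLIntegral_const, mul_comm]
  rw [hL, hWθ, hW] at hLW
  rw [mul_assoc, ← ENNReal.div_eq_inv_mul, ENNReal.le_div_iff_mul_le
    (Or.inl (mul_ne_zero ha0 ha0)) (Or.inl (ENNReal.mul_ne_top hat hat))]
  refine hLW.trans_eq ?_
  ring

/-! ### Passage to H^1 and the lower bound for λ -/

theorem tangentPart_sq {N : ℕ} {F : Euc N → ℝ} (hF : ContDiff ℝ ∞ F) (v : Euc N) :
    tangentPart (fun z => F z ^ 2) v = (2 : ℝ) • F v • tangentPart F v := by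
  have hd : DifferentiableAt ℝ F v := hF.differentiable (by simp) v
  have h1 : gradient (fun z => F z ^ 2) v = (2 * F v) • gradient F v := by
    unfold gradient
    rw [(hd.hasFDerivAt.pow 2).fderiv]
    simp
  simp only [tangentPart, h1, inner_smul_left, RCLike.conj_to_real]
  module

theorem continuous_tangentialGradient {N : ℕ} {F : Euc N → ℝ} (hF : ContDiff ℝ ∞ F) :
    Continuous (tangentialGradient F) :=
  (continuous_tangentPart hF).comp continuous_subtype_val

theorem tendsto_eLpNorm_of_sub {α E : Type*} [MeasurableSpace α] [NormedAddCommGroup E]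
    {μ : Measure α} {p : ℝ≥0∞} (hp : 1 ≤ p) {f : ℕ → α → E} {g : α → E}
    (hf : ∀ n, AEStronglyMeasurable (f n) μ) (hg : MemLp g p μ)
    (h : Tendsto (fun n => eLpNorm (fun x => f n x - g x) p μ) atTop (𝓝 0)) :
    Tendsto (fun n => eLpNorm (f n) p μ) atTop (𝓝 (eLpNorm g p μ)) := by
  have hu : ∀ n, eLpNorm (f n) p μ ≤ eLpNorm (fun x => f n x - g x) p μ + eLpNorm g p μ := by
    intro n
    have := eLpNorm_add_le (μ := μ) (p := p) ((hf n).sub hg.1) hg.1 hp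
    rwa [sub_add_cancel] at this
  have hl : ∀ n, eLpNorm g p μ - eLpNorm (fun x => f n x - g x) p μ ≤ eLpNorm (f n) p μ := by
    intro n
    rw [tsub_le_iff_left]
    have := eLpNorm_sub_le (μ := μ) (p := p) (hf n) ((hf n).sub hg.1) hp
    simp only [sub_sub_cancel] at this
    rw [add_comm]
    exact this
  refine tendsto_of_tendsto_of_tendsto_of_le_of_le ?_ ?_ hl hu
  · simpa using ENNReal.Tendsto.sub tendsto_const_nhds h (Or.inl hg.2.ne)
  · simpa using h.add_const (eLpNorm g p μ)

/-- The `L^1` Poincaré inequality for the square of a function in `H^1` of the sphere. -/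
theorem exists_lintegral_enorm_sq_sub_le {N : ℕ} (hN : 2 ≤ N) :
    ∃ C : ℝ≥0∞, C ≠ ⊤ ∧ ∀ (φ : Sph N → ℝ) (G : Sph N → Euc N), HasSphGradient φ G →
      ∫⁻ x, ∫⁻ y, ‖φ y ^ 2 - φ x ^ 2‖ₑ ∂(sphMeasure N) ∂(sphMeasure N) ≤
        C * (eLpNorm φ 2 (sphMeasure N) * eLpNorm G 2 (sphMeasure N)) := by
  obtain ⟨C, hC, hP⟩ := exists_lintegral_enorm_sub_le hN
  refine ⟨C * 2, ENNReal.mul_ne_top hC (by simp), fun φ G h => ?_⟩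
  obtain ⟨F, hF, hφ, hG⟩ := h.approx
  set σ := sphMeasure N
  have hFm : ∀ n, AEStronglyMeasurable (fun x : Sph N => F n x) σ := fun n =>
    ((hF n).continuous.comp continuous_subtype_val).aestronglyMeasurable
  have hTm : ∀ n, AEStronglyMeasurable (tangentialGradient (F n)) σ := fun n =>
    (continuous_tangentialGradient (hF n)).aestronglyMeasurable
  have hsmooth : ∀ n, ∫⁻ x, ∫⁻ y, ‖F n (y : Euc N) ^ 2 - F n (x : Euc N) ^ 2‖ₑ ∂σ ∂σ ≤
      C * 2 * (eLpNorm (fun x : Sph N => F n x) 2 σ * eLpNorm (tangentialGradient (F n)) 2 σ) := by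
    intro n
    refine (hP (fun z => F n z ^ 2) ((hF n).pow 2)).trans ?_
    rw [mul_assoc]
    gcongr
    -- Cauchy–Schwarz for ∇(F²) = 2F∇F.
    have h1 := eLpNorm_smul_le_mul_eLpNorm (μ := σ) (p := 2) (q := 2) (r := 1) (hTm n) (hFm n)
    have h2 : ∫⁻ x, ‖tangentPart (fun z => F n z ^ 2) (x : Euc N)‖ₑ ∂σ =
        2 * eLpNorm ((fun x : Sph N => F n x) • tangentialGradient (F n)) 1 σ := by
      rw [eLpNorm_one_eq_lintegral_enorm, ← lintegral_const_mul' _ _ (by simp)]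
      refine lintegral_congr fun x => ?_
      rw [tangentPart_sq (hF n), enorm_smul]
      simp [tangentialGradient, tangentPart, Real.enorm_eq_ofReal]
    rw [h2]
    gcongr
  have hms : TendstoInMeasure σ (fun n (x : Sph N) => F n x) atTop φ :=
    tendstoInMeasure_of_tendsto_eLpNorm (by norm_num) hFm h.memLp.1 hφ
  obtain ⟨ns, hns, hae⟩ := hms.exists_seq_tendsto_ae
  have hlim : Tendsto (fun i => C * 2 * (eLpNorm (fun x : Sph N => F (ns i) x) 2 σ *
      eLpNorm (tangentialGradient (F (ns i))) 2 σ)) atTop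
      (𝓝 (C * 2 * (eLpNorm φ 2 σ * eLpNorm G 2 σ))) := by
    refine ENNReal.Tendsto.const_mul ?_ (Or.inr (ENNReal.mul_ne_top hC (by simp)))
    exact ENNReal.Tendsto.mul
      ((tendsto_eLpNorm_of_sub (by norm_num) hFm h.memLp hφ).comp hns.tendsto_atTop)
      (Or.inr h.memLp_grad.2.ne)
      ((tendsto_eLpNorm_of_sub (by norm_num) hTm h.memLp_grad hG).comp hns.tendsto_atTop)
      (Or.inr h.memLp.2.ne)
  have hcont : ∀ i, Continuous fun p : Sph N × Sph N =>
      ‖F (ns i) (p.2 : Euc N) ^ 2 - F (ns i) (p.1 : Euc N) ^ 2‖ₑ := by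
    intro i
    have := (hF (ns i)).continuous
    fun_prop
  -- Fatou, once in each variable, along a subsequence converging almost everywhere.
  calc ∫⁻ x, ∫⁻ y, ‖φ y ^ 2 - φ x ^ 2‖ₑ ∂σ ∂σ
      = ∫⁻ x, ∫⁻ y, liminf (fun i => ‖F (ns i) (y : Euc N) ^ 2 - F (ns i) (x : Euc N) ^ 2‖ₑ)
          atTop ∂σ ∂σ := by
        refine lintegral_congr_ae ?_
        filter_upwards [hae] with x hx
        refine lintegral_congr_ae ?_
        filter_upwards [hae] with y hy
        exact (((hy.pow 2).sub (hx.pow 2)).enorm).liminf_eq.symm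
    _ ≤ ∫⁻ x, liminf (fun i => ∫⁻ y, ‖F (ns i) (y : Euc N) ^ 2 - F (ns i) (x : Euc N) ^ 2‖ₑ ∂σ)
          atTop ∂σ :=
        lintegral_mono fun x => lintegral_liminf_le fun i =>
          ((hcont i).comp (Continuous.prodMk_right x)).measurable
    _ ≤ liminf (fun i => ∫⁻ x, ∫⁻ y, ‖F (ns i) (y : Euc N) ^ 2 - F (ns i) (x : Euc N) ^ 2‖ₑ ∂σ ∂σ)
          atTop :=
        lintegral_liminf_le fun i => (hcont i).measurable.lintegral_prod_right'
    _ ≤ liminf (fun i => C * 2 * (eLpNorm (fun x : Sph N => F (ns i) x) 2 σ *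
          eLpNorm (tangentialGradient (F (ns i))) 2 σ)) atTop :=
        liminf_le_liminf (Eventually.of_forall fun i => hsmooth (ns i))
    _ = C * 2 * (eLpNorm φ 2 σ * eLpNorm G 2 σ) := hlim.liminf_eq

theorem eLpNorm_two_sq {α E : Type*} [MeasurableSpace α] [NormedAddCommGroup E] {μ : Measure α}
    (f : α → E) : eLpNorm f 2 μ ^ 2 = ∫⁻ x, ‖f x‖ₑ ^ 2 ∂μ := by
  rw [eLpNorm_eq_lintegral_rpow_enorm_toReal (by simp) (by simp), ← ENNReal.rpow_natCast,
    ← ENNReal.rpow_mul]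
  simp

/-- A function whose zero set is large has a large optimal value. -/
theorem exists_measure_sq_le_lam {N : ℕ} (hN : 2 ≤ N) :
    ∃ C : ℝ≥0∞, C ≠ ⊤ ∧ ∀ u : Sph N → ℝ, AEStronglyMeasurable u (sphMeasure N) →
      (sphMeasure N {x | u x = 0}) ^ 2 ≤ C * lam u := by
  obtain ⟨C, hC, hP⟩ := exists_lintegral_enorm_sq_sub_le hN
  -- The extra 1 only makes the constant nonzero, so that one can divide by it in `ℝ≥0∞`.
  refine ⟨C ^ 2 + 1, by finiteness, fun u hu => ?_⟩
  rw [mul_comm, ← ENNReal.div_le_iff_le_mul (Or.inl (by simp)) (Or.inl (by finiteness))]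
  refine le_iInf₂ fun φ G => le_iInf₂ fun h h0 => le_iInf fun hZ => ?_
  rw [← eLpNorm_two_sq, ← eLpNorm_two_sq]
  set σ := sphMeasure N
  set Z := {x | u x = 0}
  set A := eLpNorm φ 2 σ with hA
  set B := eLpNorm G 2 σ
  have hA0 : A ≠ 0 := fun hA0 => h0 ((eLpNorm_eq_zero_iff h.memLp.1 (by simp)).1 hA0)
  have hAt : A ≠ ⊤ := h.memLp.2.ne
  have hZm : NullMeasurableSet Z σ := hu.aemeasurable.nullMeasurable (measurableSet_singleton 0)
  have key : σ Z * A ^ 2 ≤ C * (A * B) := by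
    refine le_trans ?_ (hP φ G h)
    refine le_trans (le_of_eq ?_) (setLIntegral_le_lintegral Z _)
    -- For almost every x in Z, φ(x) = 0 and the inner integral is the full ∫ φ².
    have h1 : ∫⁻ x in Z, ∫⁻ y, ‖φ y ^ 2 - φ x ^ 2‖ₑ ∂σ ∂σ = ∫⁻ x in Z, A ^ 2 ∂σ := by
      refine lintegral_congr_ae ?_
      filter_upwards [ae_restrict_mem₀ hZm,
        ae_restrict_of_ae (measure_eq_zero_iff_ae_notMem.1 hZ)] with x hx hx2
      have hφx : φ x = 0 := by
        by_contra hne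
        exact hx2 ⟨hne, hx⟩
      rw [hA, eLpNorm_two_sq]
      simp [hφx, enorm_pow]
    rw [h1, setLIntegral_const, mul_comm]
  have key2 : σ Z * A ≤ C * B := by
    rw [← ENNReal.mul_le_mul_iff_left hA0 hAt]
    calc σ Z * A * A = σ Z * A ^ 2 := by ring
      _ ≤ C * (A * B) := key
      _ = C * B * A := by ring
  rw [ENNReal.div_le_iff_le_mul (Or.inl (by simp)) (Or.inl (by finiteness)), ← ENNReal.mul_div_right_comm,
    ENNReal.le_div_iff_mul_le (Or.inl (by positivity)) (Or.inl (by finiteness))]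
  calc σ Z ^ 2 * A ^ 2 = (σ Z * A) ^ 2 := by ring
    _ ≤ (C * B) ^ 2 := by gcongr
    _ = B ^ 2 * C ^ 2 := by ring
    _ ≤ B ^ 2 * (C ^ 2 + 1) := by gcongr; exact le_self_add

/-! ### Monotonicity of γ and positivity of the optimal value -/

theorem gam_mono (N : ℕ) : Monotone (gam N) := by
  intro s t hst
  unfold gam
  by_cases ht : t = ⊤
  · simp [ht]
  · have hs : s ≠ ⊤ := ne_top_of_le_ne_top ht hst
    rw [if_neg hs, if_neg ht]
    gcongr

theorem gam_pos {N : ℕ} (hN : 2 ≤ N) {t : ℝ≥0∞} (ht : 0 < t) : 0 < gam N t := by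
  unfold gam
  split_ifs with h
  · simp
  · have hN' : (2 : ℝ) ≤ N := by exact_mod_cast hN
    rw [ENNReal.ofReal_pos, sub_pos]
    exact Real.lt_sqrt_of_sq_lt (by linarith [ENNReal.toReal_pos ht.ne' h])

theorem alphaOpt_pos {k N : ℕ} (hk : 2 ≤ k) (hN : 2 ≤ N) : 0 < alphaOpt k N := by
  obtain ⟨C, hC, hP⟩ := exists_measure_sq_le_lam hN
  have : Nontrivial (Euc N) := by
    have : Nonempty (Fin N) := ⟨⟨0, by omega⟩⟩
    infer_instance
  set σ := sphMeasure N
  have hσ : σ Set.univ ≠ 0 := by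
    rw [Ne, Measure.measure_univ_eq_zero]
    exact Measure.toSphere_ne_zero _
  have hk0 : (k : ℝ≥0∞) ≠ 0 := by simp; omega
  have hσk : σ Set.univ / k ≠ 0 := ENNReal.div_ne_zero.2 ⟨hσ, by simp⟩
  have ht : 0 < (σ Set.univ / k) ^ 2 / C :=
    ENNReal.div_pos (pow_ne_zero _ hσk) hC
  refine (gam_pos hN ht).trans_le ?_
  refine le_iInf₂ fun u hu => le_iInf fun h0 => ?_
  have hum : ∀ j, AEStronglyMeasurable (u j) σ := fun j => by
    obtain ⟨G, hG⟩ := hu j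
    exact hG.memLp.1
  have hae : ∀ᵐ x ∂σ, ∃ j, u j x = 0 := by
    rw [lintegral_eq_zero_iff' (Finset.aemeasurable_fun_prod _ fun j _ =>
      (hum j).enorm.pow_const 2)] at h0
    filter_upwards [h0] with x hx
    simp only [Pi.zero_apply, Finset.prod_eq_zero_iff] at hx
    obtain ⟨j, -, hj⟩ := hx
    exact ⟨j, by simpa using hj⟩
  have hsum : σ Set.univ ≤ ∑ j, σ {x | u j x = 0} := by
    calc σ Set.univ ≤ σ (⋃ j, {x | u j x = 0}) := by
          refine measure_mono_ae ?_
          filter_upwards [hae] with x hx _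
          obtain ⟨j, hj⟩ := hx
          exact Set.mem_iUnion.2 ⟨j, hj⟩
      _ ≤ ∑ j, σ {x | u j x = 0} := measure_iUnion_fintype_le _ _
  -- Pigeonhole: the k zero sets cover the sphere up to a null set.
  obtain ⟨j, hj⟩ : ∃ j, σ Set.univ / k ≤ σ {x | u j x = 0} := by
    by_contra! hlt
    have : Nonempty (Fin k) := ⟨⟨0, by omega⟩⟩
    have h1 : ∑ j : Fin k, σ {x | u j x = 0} < ∑ j : Fin k, σ Set.univ / k :=
      ENNReal.sum_lt_sum_of_nonempty Finset.univ_nonempty fun j _ => hlt j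
    rw [Finset.sum_const, Finset.card_univ, Fintype.card_fin, nsmul_eq_mul,
      ENNReal.mul_div_cancel hk0 (by simp)] at h1
    exact absurd h1 (not_lt.2 hsum)
  refine le_trans ?_ (Finset.single_le_sum (fun _ _ => zero_le) (Finset.mem_univ j))
  refine gam_mono N (ENNReal.div_le_of_le_mul' (le_trans ?_ (hP (u j) (hum j))))
  gcongr

/-! ### The positive part of a linear form belongs to H^1 -/

theorem tendsto_eLpNorm_two_zero_of_bounded {α E : Type*} [MeasurableSpace α]
    [NormedAddCommGroup E] {μ : Measure α} [IsFiniteMeasure μ] {f : ℕ → α → E} {M : ℝ}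
    (hf : ∀ n, AEStronglyMeasurable (f n) μ) (hM : ∀ n x, ‖f n x‖ ≤ M)
    (h : ∀ x, Tendsto (fun n => f n x) atTop (𝓝 0)) :
    Tendsto (fun n => eLpNorm (f n) 2 μ) atTop (𝓝 0) := by
  have h1 : Tendsto (fun n => ∫⁻ x, ‖f n x‖ₑ ^ 2 ∂μ) atTop (𝓝 (∫⁻ _, 0 ∂μ)) := by
    refine tendsto_lintegral_of_dominated_convergence' (fun _ => ENNReal.ofReal M ^ 2)
      (fun n => (hf n).enorm.pow_const 2) (fun n => Eventually.of_forall fun x => ?_) ?_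
      (Eventually.of_forall fun x => ?_)
    · refine pow_le_pow_left' ?_ 2
      rw [← ofReal_norm]
      exact ENNReal.ofReal_le_ofReal (hM n x)
    · rw [lintegral_const]
      finiteness
    · have := (h x).enorm
      simpa using ENNReal.Tendsto.pow (n := 2) this
  simp only [lintegral_zero, ← eLpNorm_two_sq] at h1
  have h2 := h1.ennrpow_const (1 / 2)
  have h3 : ∀ a : ℝ≥0∞, (a ^ 2) ^ (1 / 2 : ℝ) = a := fun a => by
    rw [← ENNReal.rpow_natCast, ← ENNReal.rpow_mul]
    simp
  simpa only [h3, ENNReal.zero_rpow_of_pos (show (0 : ℝ) < 1 / 2 by norm_num)] using h2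

theorem tangentialGradient_comp_inner {N : ℕ} (e : Euc N) {g : ℝ → ℝ} {g' : ℝ} (x : Sph N)
    (hg : HasDerivAt g g' (inner ℝ e (x : Euc N))) :
    tangentialGradient (fun z : Euc N => g (inner ℝ e z)) x =
      g' • (e - (inner ℝ e (x : Euc N)) • (x : Euc N)) := by
  have h1 : HasFDerivAt (fun z : Euc N => (inner ℝ e z : ℝ)) (innerSL ℝ e) (x : Euc N) :=
    (innerSL ℝ e).hasFDerivAt
  have h2 : gradient (fun z : Euc N => g (inner ℝ e z)) (x : Euc N) = g' • e := by
    refine HasGradientAt.gradient ?_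
    rw [hasGradientAt_iff_hasFDerivAt]
    have h3 := hg.comp_hasFDerivAt (x : Euc N) h1
    refine h3.congr_fderiv ?_
    ext v
    simp
  simp only [tangentialGradient, h2, inner_smul_left, RCLike.conj_to_real]
  module

/-- A smooth approximation of the positive part. -/
noncomputable def smoothPos (δ t : ℝ) : ℝ := ((t - δ) + √((t - δ) ^ 2 + δ ^ 4)) / 2

theorem contDiff_smoothPos {δ : ℝ} (hδ : 0 < δ) : ContDiff ℝ ∞ (smoothPos δ) := by
  unfold smoothPos
  refine ContDiff.div_const (ContDiff.add (by fun_prop) (ContDiff.sqrt (by fun_prop) fun t => ?_)) _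
  exact (add_pos_of_nonneg_of_pos (sq_nonneg (t - δ)) (pow_pos hδ 4)).ne'

theorem hasDerivAt_smoothPos {δ : ℝ} (hδ : 0 < δ) (t : ℝ) :
    HasDerivAt (smoothPos δ) ((1 + (t - δ) / √((t - δ) ^ 2 + δ ^ 4)) / 2) t := by
  have h1 : HasDerivAt (fun t => t - δ) 1 t := (hasDerivAt_id t).sub_const δ
  have h0 : 0 < (t - δ) ^ 2 + δ ^ 4 := add_pos_of_nonneg_of_pos (sq_nonneg _) (pow_pos hδ 4)
  have h2 := ((h1.pow 2).add_const (δ ^ 4)).sqrt h0.ne'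
  refine ((h1.add h2).div_const 2).congr_deriv ?_
  simp
  field_simp

theorem abs_smoothPos_sub_le {δ t : ℝ} (hδ : 0 < δ) (hδ1 : δ ≤ 1) (ht : |t| ≤ 1) :
    |smoothPos δ t - max t 0| ≤ 4 := by
  obtain ⟨h1, h2⟩ := abs_le.1 ht
  have h3 : √((t - δ) ^ 2 + δ ^ 4) ≤ 3 := by
    rw [Real.sqrt_le_left (by norm_num)]
    have : δ ^ 4 ≤ 1 := pow_le_one₀ hδ.le hδ1
    nlinarith
  have h4 := Real.sqrt_nonneg ((t - δ) ^ 2 + δ ^ 4)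
  have h5 : max t 0 ≤ 1 := max_le h2 zero_le_one
  have h6 : 0 ≤ max t 0 := le_max_right _ _
  unfold smoothPos
  rw [abs_le]
  constructor <;> linarith

theorem abs_deriv_smoothPos_le (δ t : ℝ) :
    |(1 + (t - δ) / √((t - δ) ^ 2 + δ ^ 4)) / 2| ≤ 1 := by
  have h : |(t - δ) / √((t - δ) ^ 2 + δ ^ 4)| ≤ 1 := by
    rw [abs_div, abs_of_nonneg (Real.sqrt_nonneg _)]
    have h4 : 0 ≤ δ ^ 4 := by positivity
    exact div_le_one_of_le₀ (Real.abs_le_sqrt (by linarith)) (Real.sqrt_nonneg _)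
  obtain ⟨h1, h2⟩ := abs_le.1 h
  rw [abs_le]
  constructor <;> linarith

theorem tendsto_smoothPos (t : ℝ) {δ : ℕ → ℝ} (hδ : Tendsto δ atTop (𝓝 0)) :
    Tendsto (fun n => smoothPos (δ n) t) atTop (𝓝 (max t 0)) := by
  have h : Continuous fun d : ℝ => smoothPos d t := by unfold smoothPos; fun_prop
  have h1 := (h.tendsto 0).comp hδ
  have h2 : smoothPos 0 t = max t 0 := by
    rcases le_total 0 t with ht | ht
    · simp [smoothPos, Real.sqrt_sq_eq_abs, abs_of_nonneg ht, max_eq_left ht]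
    · simp [smoothPos, Real.sqrt_sq_eq_abs, abs_of_nonpos ht, max_eq_right ht]
  rwa [h2] at h1

/-- The shift by δ, large compared with the smoothing scale δ², makes the derivative at t = 0 tend
to 0 rather than 1/2. Convergence then holds at every point, and the equator needs no separate
null-set argument. -/
theorem tendsto_deriv_smoothPos (t : ℝ) {δ : ℕ → ℝ} (hδ0 : ∀ n, 0 < δ n)
    (hδ : Tendsto δ atTop (𝓝 0)) :
    Tendsto (fun n => (1 + (t - δ n) / √((t - δ n) ^ 2 + δ n ^ 4)) / 2) atTop
      (𝓝 (if 0 < t then 1 else 0)) := by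
  by_cases ht : t = 0
  · have h : Continuous fun d : ℝ => (1 - 1 / √(1 + d ^ 2)) / 2 := by
      refine Continuous.div_const (continuous_const.sub (Continuous.div continuous_const
        (by fun_prop) fun d => ?_)) _
      positivity
    have h1 := (h.tendsto 0).comp hδ
    simp only [ht, lt_irrefl, if_false]
    refine Tendsto.congr (fun n => ?_) (by simpa using h1)
    have hn := hδ0 n
    have h2 : √((0 - δ n) ^ 2 + δ n ^ 4) = δ n * √(1 + δ n ^ 2) := by
      rw [show (0 - δ n) ^ 2 + δ n ^ 4 = δ n ^ 2 * (1 + δ n ^ 2) by ring,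
        Real.sqrt_mul (by positivity), Real.sqrt_sq hn.le]
    simp only [Function.comp_apply, h2]
    field_simp
    ring
  · have h : ContinuousAt (fun d : ℝ => (1 + (t - d) / √((t - d) ^ 2 + d ^ 4)) / 2) 0 := by
      refine ContinuousAt.div_const (continuousAt_const.add (ContinuousAt.div
        (by fun_prop) (by fun_prop) ?_)) _
      simpa [Real.sqrt_sq_eq_abs] using ht
    have h1 : Tendsto (fun n => (1 + (t - δ n) / √((t - δ n) ^ 2 + δ n ^ 4)) / 2) atTop
        (𝓝 ((1 + (t - 0) / √((t - 0) ^ 2 + (0 : ℝ) ^ 4)) / 2)) := Tendsto.comp h hδ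
    have h2 : (1 + (t - 0) / √((t - 0) ^ 2 + (0 : ℝ) ^ 4)) / 2 = if 0 < t then 1 else 0 := by
      rcases lt_or_gt_of_ne ht with h | h
      · simp [Real.sqrt_sq_eq_abs, abs_of_neg h, h.le, div_neg, div_self ht]
      · simp [Real.sqrt_sq_eq_abs, abs_of_pos h, h, div_self ht]
    rwa [h2] at h1

/-- The positive part of a linear form. -/
noncomputable def posLin {N : ℕ} (e : Euc N) (x : Sph N) : ℝ := max (inner ℝ e (x : Euc N)) 0

/-- The tangential gradient of `posLin e`. -/
noncomputable def posLinGrad {N : ℕ} (e : Euc N) (x : Sph N) : Euc N :=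
  (if 0 < (inner ℝ e (x : Euc N) : ℝ) then (1 : ℝ) else 0) •
    (e - (inner ℝ e (x : Euc N) : ℝ) • (x : Euc N))

theorem abs_inner_sph_le {N : ℕ} {e : Euc N} (he : ‖e‖ = 1) (x : Sph N) :
    |(inner ℝ e (x : Euc N) : ℝ)| ≤ 1 := by
  have := abs_real_inner_le_norm e (x : Euc N)
  simpa [he] using this

theorem norm_sub_inner_smul_sq {N : ℕ} {e : Euc N} (he : ‖e‖ = 1) (x : Sph N) :
    ‖e - (inner ℝ e (x : Euc N) : ℝ) • (x : Euc N)‖ ^ 2 = 1 - (inner ℝ e (x : Euc N) : ℝ) ^ 2 := by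
  have hx : ‖(x : Euc N)‖ = 1 := by simp
  rw [@norm_sub_sq_real, norm_smul, inner_smul_right, he, mul_pow, hx, Real.norm_eq_abs, sq_abs]
  ring

theorem hasSphGradient_posLin {N : ℕ} {e : Euc N} (he : ‖e‖ = 1) :
    HasSphGradient (posLin e) (posLinGrad e) := by
  have hi : Continuous fun x : Sph N => (inner ℝ e (x : Euc N) : ℝ) := by fun_prop
  have hφ : AEStronglyMeasurable (posLin e) (sphMeasure N) := by
    have : Continuous (posLin e) := hi.max continuous_const
    exact this.aestronglyMeasurable
  have hGm : AEStronglyMeasurable (posLinGrad e) (sphMeasure N) := by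
    have h1 : Continuous fun x : Sph N => e - (inner ℝ e (x : Euc N) : ℝ) • (x : Euc N) := by
      fun_prop
    have h2 : Measurable fun x : Sph N =>
        if 0 < (inner ℝ e (x : Euc N) : ℝ) then (1 : ℝ) else 0 :=
      Measurable.ite (measurableSet_lt measurable_const hi.measurable) measurable_const
        measurable_const
    exact h2.aestronglyMeasurable.smul h1.aestronglyMeasurable
  have hproj : ∀ x : Sph N, ‖e - (inner ℝ e (x : Euc N) : ℝ) • (x : Euc N)‖ ≤ 1 := fun x => by
    refine (sq_le_one_iff₀ (norm_nonneg _)).1 ?_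
    rw [norm_sub_inner_smul_sq he]
    linarith [sq_nonneg (inner ℝ e (x : Euc N) : ℝ)]
  have hGb : ∀ x, ‖posLinGrad e x‖ ≤ 1 := fun x => by
    unfold posLinGrad
    split_ifs
    · simpa using hproj x
    · simp
  let δ : ℕ → ℝ := fun n => 1 / ((n : ℝ) + 1)
  have hδ0 : ∀ n, 0 < δ n := fun n => by positivity
  have hδ1 : ∀ n, δ n ≤ 1 := fun n =>
    div_le_one_of_le₀ (by linarith [Nat.cast_nonneg (α := ℝ) n]) (by positivity)
  have hδ : Tendsto δ atTop (𝓝 0) := tendsto_one_div_add_atTop_nhds_zero_nat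
  have hF : ∀ n, ContDiff ℝ ∞ fun z : Euc N => smoothPos (δ n) (inner ℝ e z) := fun n =>
    (contDiff_smoothPos (hδ0 n)).comp (innerSL ℝ e).contDiff
  refine ⟨MemLp.of_bound hφ 1 (Eventually.of_forall fun x => ?_),
    MemLp.of_bound hGm 1 (Eventually.of_forall hGb),
    fun n z => smoothPos (δ n) (inner ℝ e z), hF, ?_, ?_⟩
  · rw [posLin, Real.norm_eq_abs, abs_of_nonneg (le_max_right _ _)]
    exact max_le (le_of_abs_le (abs_inner_sph_le he x)) zero_le_one
  · refine tendsto_eLpNorm_two_zero_of_bounded (M := 4) (fun n => ?_) (fun n x => ?_) fun x => ?_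
    · exact ((hF n).continuous.comp continuous_subtype_val).aestronglyMeasurable.sub hφ
    · exact abs_smoothPos_sub_le (hδ0 n) (hδ1 n) (abs_inner_sph_le he x)
    · exact tendsto_sub_nhds_zero_iff.2 (tendsto_smoothPos _ hδ)
  · refine tendsto_eLpNorm_two_zero_of_bounded (M := 2) (fun n => ?_) (fun n x => ?_) fun x => ?_
    · exact (continuous_tangentialGradient (hF n)).aestronglyMeasurable.sub hGm
    · rw [tangentialGradient_comp_inner e x (hasDerivAt_smoothPos (hδ0 n) _)]
      refine (norm_sub_le _ _).trans ?_
      have h1 := abs_deriv_smoothPos_le (δ n) (inner ℝ e (x : Euc N))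
      have h2 := hproj x
      have h3 := hGb x
      rw [norm_smul, Real.norm_eq_abs]
      have := mul_le_one₀ h1 (norm_nonneg _) h2
      linarith
    · simp only [tangentialGradient_comp_inner e x (hasDerivAt_smoothPos (hδ0 _) _)]
      rw [tendsto_sub_nhds_zero_iff]
      exact (tendsto_deriv_smoothPos _ hδ0 hδ).smul_const _

/-! ### Second moments on the sphere and the Rayleigh quotient -/

/-- The surface measure is invariant under linear isometries. -/
theorem lintegral_sph_comp_linearIsometryEquiv {N : ℕ} (hN : 0 < N) (L : Euc N ≃ₗᵢ[ℝ] Euc N)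
    {H : Euc N → ℝ≥0∞} (hH : Measurable H) :
    ∫⁻ x, H (L (x : Euc N)) ∂(sphMeasure N) = ∫⁻ x, H (x : Euc N) ∂(sphMeasure N) := by
  let ψ : ℝ → ℝ≥0∞ := (Set.Iio (1 / 2 : ℝ)).indicator 1
  have hψ : Measurable ψ := measurable_one.indicator measurableSet_Iio
  obtain ⟨h0, ht⟩ := lintegral_radial_indicator (N - 1)
  have hLm : Measurable L := L.continuous.measurable
  have hm : Measurable fun X : Euc N => H (‖X‖⁻¹ • X) * ψ ‖X‖ := by fun_prop
  have h1 := L.measurePreserving.lintegral_comp hm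
  simp only [LinearIsometryEquiv.norm_map, ← map_smul] at h1
  rw [lintegral_polar hN hH hψ, lintegral_polar hN (H := fun v => H (L v)) (hH.comp hLm) hψ] at h1
  exact (ENNReal.mul_left_inj h0 ht).1 h1

theorem lintegral_sph_neg {N : ℕ} (hN : 0 < N) {H : Euc N → ℝ≥0∞} (hH : Measurable H) :
    ∫⁻ x, H (-(x : Euc N)) ∂(sphMeasure N) = ∫⁻ x, H (x : Euc N) ∂(sphMeasure N) :=
  lintegral_sph_comp_linearIsometryEquiv hN (LinearIsometryEquiv.neg ℝ) hH

/-- A reflection exchanges any two unit vectors, so all N coordinates have the same second moment,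
and their squares add up to 1 on the sphere. -/
theorem card_mul_lintegral_inner_sq {N : ℕ} (hN : 0 < N) {e : Euc N} (he : ‖e‖ = 1) :
    (N : ℝ≥0∞) * ∫⁻ x, ‖(inner ℝ e (x : Euc N) : ℝ)‖ₑ ^ 2 ∂(sphMeasure N) =
      sphMeasure N Set.univ := by
  have hM : ∀ f : Euc N, ‖f‖ = 1 → ∫⁻ x, ‖(inner ℝ f (x : Euc N) : ℝ)‖ₑ ^ 2 ∂(sphMeasure N) =
      ∫⁻ x, ‖(inner ℝ e (x : Euc N) : ℝ)‖ₑ ^ 2 ∂(sphMeasure N) := fun f hf => by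
    let L : Euc N ≃ₗᵢ[ℝ] Euc N := (ℝ ∙ (e - f))ᗮ.reflection
    have hL : L e = f := Submodule.reflection_sub (he.trans hf.symm)
    rw [← lintegral_sph_comp_linearIsometryEquiv hN L
      (H := fun v => ‖(inner ℝ f v : ℝ)‖ₑ ^ 2) (by fun_prop)]
    simp only [← hL, LinearIsometryEquiv.inner_map_map]
  have hsum : ∀ x : Sph N, ∑ i : Fin N,
      ‖(inner ℝ (EuclideanSpace.single i (1 : ℝ)) (x : Euc N) : ℝ)‖ₑ ^ 2 = 1 := fun x => by
    have hx : ‖(x : Euc N)‖ ^ 2 = 1 := by simp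
    rw [EuclideanSpace.norm_sq_eq] at hx
    simp only [EuclideanSpace.inner_single_left, map_one, one_mul, ← ofReal_norm]
    simp only [← ENNReal.ofReal_pow (norm_nonneg _)]
    rw [← ENNReal.ofReal_sum_of_nonneg fun i _ => sq_nonneg _, hx, ENNReal.ofReal_one]
  have h1 : ∫⁻ x : Sph N, ∑ i : Fin N,
      ‖(inner ℝ (EuclideanSpace.single i (1 : ℝ)) (x : Euc N) : ℝ)‖ₑ ^ 2 ∂(sphMeasure N) =
        sphMeasure N Set.univ := by
    simp only [hsum, lintegral_one]
  rw [lintegral_finsetSum _ fun i _ => by fun_prop] at h1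
  rw [← h1, Finset.sum_congr rfl fun i _ => hM (EuclideanSpace.single i 1) (by simp)]
  simp

theorem enorm_posLin_sq {N : ℕ} (e : Euc N) (x : Sph N) :
    ‖posLin e x‖ₑ ^ 2 + ‖posLin (-e) x‖ₑ ^ 2 = ‖(inner ℝ e (x : Euc N) : ℝ)‖ₑ ^ 2 := by
  simp only [posLin, inner_neg_left]
  rcases le_total 0 (inner ℝ e (x : Euc N) : ℝ) with h | h
  · simp [h]
  · simp [h]

theorem enorm_posLinGrad_sq {N : ℕ} {e : Euc N} (he : ‖e‖ = 1) (x : Sph N) :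
    ‖posLinGrad e x‖ₑ ^ 2 = if 0 < (inner ℝ e (x : Euc N) : ℝ) then
      ENNReal.ofReal (1 - (inner ℝ e (x : Euc N) : ℝ) ^ 2) else 0 := by
  unfold posLinGrad
  split_ifs
  · rw [one_smul, ← norm_sub_inner_smul_sq he, ENNReal.ofReal_pow (norm_nonneg _), ofReal_norm]
  · simp

/-- The function is its own competitor. By the symmetry x ↦ -x, ∫ φ² is half of M = ∫ (e·x)², and ∫
|∇φ|² is at most half of ∫ (1 - (e·x)²) = N M - M. The quotient is at most N - 1. -/
theorem lam_posLin_le {N : ℕ} (hN : 2 ≤ N) {e : Euc N} (he : ‖e‖ = 1) :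
    lam (posLin e) ≤ ((N - 1 : ℕ) : ℝ≥0∞) := by
  have hN0 : 0 < N := by omega
  have : Nontrivial (Euc N) := by
    have : Nonempty (Fin N) := ⟨⟨0, by omega⟩⟩
    infer_instance
  set σ := sphMeasure N
  set M := ∫⁻ x, ‖(inner ℝ e (x : Euc N) : ℝ)‖ₑ ^ 2 ∂σ with hMdef
  have hNM : (N : ℝ≥0∞) * M = σ Set.univ := card_mul_lintegral_inner_sq hN0 he
  have hM0 : M ≠ 0 := by
    intro h
    rw [h, mul_zero] at hNM
    exact Measure.toSphere_ne_zero _ (Measure.measure_univ_eq_zero.1 hNM.symm)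
  have hMt : M ≠ ⊤ := by
    intro h
    rw [h, ENNReal.mul_top (by simp; omega)] at hNM
    exact measure_ne_top σ _ hNM.symm
  have hP : 2 * ∫⁻ x, ‖posLin e x‖ₑ ^ 2 ∂σ = M := by
    have h1 : ∫⁻ x, ‖posLin (-e) x‖ₑ ^ 2 ∂σ = ∫⁻ x, ‖posLin e x‖ₑ ^ 2 ∂σ := by
      simpa [posLin] using lintegral_sph_neg hN0
        (H := fun v => ‖max (inner ℝ e v : ℝ) 0‖ₑ ^ 2) (by fun_prop)
    have hm : Measurable fun x => ‖posLin e x‖ₑ ^ 2 := by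
      unfold posLin
      fun_prop
    rw [two_mul]
    nth_rewrite 2 [← h1]
    rw [← lintegral_add_left hm]
    exact lintegral_congr fun x => enorm_posLin_sq e x
  have hR : ∫⁻ x, ENNReal.ofReal (1 - (inner ℝ e (x : Euc N) : ℝ) ^ 2) ∂σ =
      ((N - 1 : ℕ) : ℝ≥0∞) * M := by
    have h1 : (∫⁻ x, ENNReal.ofReal (1 - (inner ℝ e (x : Euc N) : ℝ) ^ 2) ∂σ) + M =
        ((N - 1 : ℕ) : ℝ≥0∞) * M + M := by
      rw [hMdef, ← lintegral_add_left (by fun_prop), ← hMdef, ← add_one_mul, ← Nat.cast_add_one,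
        Nat.sub_add_cancel (by omega), hNM, ← lintegral_one]
      refine lintegral_congr fun x => ?_
      have h2 := abs_inner_sph_le he x
      have h3 : (inner ℝ e (x : Euc N) : ℝ) ^ 2 ≤ 1 := (sq_le_one_iff_abs_le_one _).2 h2
      rw [← ofReal_norm, ← ENNReal.ofReal_pow (norm_nonneg _), Real.norm_eq_abs, sq_abs,
        ← ENNReal.ofReal_add (by linarith) (sq_nonneg _)]
      simp
    exact (ENNReal.add_left_inj hMt).1 h1
  have hQ : 2 * ∫⁻ x, ‖posLinGrad e x‖ₑ ^ 2 ∂σ ≤ ((N - 1 : ℕ) : ℝ≥0∞) * M := by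
    let H : Euc N → ℝ≥0∞ := fun v =>
      if 0 < (inner ℝ e v : ℝ) then ENNReal.ofReal (1 - (inner ℝ e v : ℝ) ^ 2) else 0
    have hH : Measurable H := Measurable.ite
      (measurableSet_lt measurable_const (by fun_prop)) (by fun_prop) measurable_const
    have h1 : ∫⁻ x, ‖posLinGrad e x‖ₑ ^ 2 ∂σ = ∫⁻ x, H (x : Euc N) ∂σ :=
      lintegral_congr fun x => enorm_posLinGrad_sq he x
    rw [h1, two_mul]
    nth_rewrite 2 [← lintegral_sph_neg hN0 hH]
    have hHs : Measurable fun x : Sph N => H (x : Euc N) := hH.comp measurable_subtype_coe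
    rw [← lintegral_add_left hHs, ← hR]
    refine lintegral_mono fun x => ?_
    simp only [H, inner_neg_right, neg_sq]
    -- The linear form cannot be positive at both x and -x; on the equator both terms vanish, so an
    -- inequality suffices.
    split_ifs
    · linarith
    · simp
    · simp
    · simp
  rw [← hP, mul_left_comm, ENNReal.mul_le_mul_iff_right (by simp) (by simp)] at hQ
  have hP0 : ∫⁻ x, ‖posLin e x‖ₑ ^ 2 ∂σ ≠ 0 := by
    intro h
    rw [h, mul_zero] at hP
    exact hM0 hP.symm
  have hne : ¬ posLin e =ᵐ[σ] 0 := by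
    intro h
    refine hP0 ?_
    rw [← lintegral_zero]
    refine lintegral_congr_ae ?_
    filter_upwards [h] with x hx
    simp [hx]
  refine (iInf₂_le_of_le (posLin e) (posLinGrad e) (iInf₂_le_of_le (hasSphGradient_posLin he) hne
    (iInf_le_of_le ?_ le_rfl))).trans (ENNReal.div_le_of_le_mul hQ)
  rw [show {x | posLin e x ≠ 0} ∩ {x | posLin e x = 0} = ∅ from ?_, measure_empty]
  ext x
  simp

/-! ### The competitor for the upper bound -/

theorem hasSphGradient_one (N : ℕ) : HasSphGradient (N := N) (fun _ => 1) (fun _ => 0) := by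
  refine ⟨memLp_const _, memLp_const _, fun _ _ => 1, fun _ => contDiff_const, ?_, ?_⟩
  · simp
  · simp [tangentialGradient, gradient]

theorem lam_one {N : ℕ} (hN : 0 < N) : lam (N := N) (fun _ => 1) = 0 := by
  have : Nontrivial (Euc N) := by
    have : Nonempty (Fin N) := ⟨⟨0, hN⟩⟩
    infer_instance
  refine le_antisymm ?_ zero_le
  refine (iInf₂_le_of_le (fun _ => 1) (fun _ => 0) (iInf₂_le_of_le (hasSphGradient_one N) ?_
    (iInf_le_of_le ?_ le_rfl))).trans ?_
  · intro h
    have h1 : ∀ᵐ x ∂(sphMeasure N), False := by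
      filter_upwards [h] with x hx
      exact one_ne_zero hx
    rw [eventually_false_iff_eq_bot, ae_eq_bot] at h1
    exact Measure.toSphere_ne_zero _ h1
  · simp
  · simp

theorem gam_zero {N : ℕ} (hN : 2 ≤ N) : gam N 0 = 0 := by
  have hN' : (2 : ℝ) ≤ N := by exact_mod_cast hN
  simp [gam, Real.sqrt_sq (show 0 ≤ ((N : ℝ) - 2) / 2 by linarith)]

/-- The radicand is a perfect square: ((N-2)/2)² + (N-1) = (N/2)². -/
theorem gam_pred {N : ℕ} (hN : 2 ≤ N) : gam N ((N - 1 : ℕ) : ℝ≥0∞) = 1 := by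
  have hN' : (2 : ℝ) ≤ N := by exact_mod_cast hN
  have h : (((N : ℝ) - 2) / 2) ^ 2 + ((N : ℝ) - 1) = ((N : ℝ) / 2) ^ 2 := by ring
  rw [gam, if_neg (ENNReal.natCast_ne_top _), ENNReal.toReal_natCast, Nat.cast_sub (by omega),
    Nat.cast_one, h, Real.sqrt_sq (by positivity), ← ENNReal.ofReal_one]
  congr 1
  ring

theorem alphaOpt_le_two {k N : ℕ} (hk : 2 ≤ k) (hN : 2 ≤ N) : alphaOpt k N ≤ 2 := by
  let e : Euc N := EuclideanSpace.single ⟨0, by omega⟩ 1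
  have he : ‖e‖ = 1 := by simp [e]
  have he' : ‖-e‖ = 1 := by rw [norm_neg, he]
  let i0 : Fin k := ⟨0, by omega⟩
  let i1 : Fin k := ⟨1, by omega⟩
  have hi : i1 ≠ i0 := by simp [i0, i1]
  -- The first two functions already have product zero, so the remaining ones can be constant, at no
  -- cost.
  let u : Fin k → Sph N → ℝ := fun j =>
    if j = i0 then posLin e else if j = i1 then posLin (-e) else fun _ => 1
  have hu0 : u i0 = posLin e := if_pos rfl
  have hu1 : u i1 = posLin (-e) := by simp [u, hi]
  have hu : ∀ j, MemH1 (u j) := fun j => by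
    simp only [u]
    split_ifs
    · exact ⟨_, hasSphGradient_posLin he⟩
    · exact ⟨_, hasSphGradient_posLin he'⟩
    · exact ⟨_, hasSphGradient_one N⟩
  have hprod : ∀ x, ∏ j, ‖u j x‖ₑ ^ 2 = 0 := fun x => by
    rcases le_total 0 (inner ℝ e (x : Euc N) : ℝ) with h | h
    · refine Finset.prod_eq_zero (Finset.mem_univ i1) ?_
      simp [hu1, posLin, h]
    · refine Finset.prod_eq_zero (Finset.mem_univ i0) ?_
      simp [hu0, posLin, h]
  refine (iInf₂_le_of_le u hu (iInf_le _ (by simp [hprod]))).trans ?_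
  have hj : ∀ j, gam N (lam (u j)) ≤ (if j = i0 then 1 else 0) + (if j = i1 then 1 else 0) :=
    fun j => by
      by_cases h0 : j = i0
      · rw [if_pos h0, h0, hu0]
        refine le_add_right ?_
        rw [← gam_pred hN]
        exact gam_mono N (lam_posLin_le hN he)
      by_cases h1 : j = i1
      · rw [if_pos h1, h1, hu1]
        refine le_add_left ?_
        rw [← gam_pred hN]
        exact gam_mono N (lam_posLin_le hN he')
      simp only [u, h0, h1, if_false, lam_one (show 0 < N by omega), gam_zero hN, add_zero, le_refl]
  refine (Finset.sum_le_sum fun j _ => hj j).trans_eq ?_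
  rw [Finset.sum_add_distrib]
  simp [one_add_one_eq_two]

end OverlappingPartition

theorem mainTheorem10 (k N : ℕ) (hk : 2 ≤ k) (hN : 2 ≤ N) :
    0 < OverlappingPartition.alphaOpt k N ∧ OverlappingPartition.alphaOpt k N ≤ 2 :=
  ⟨OverlappingPartition.alphaOpt_pos hk hN, OverlappingPartition.alphaOpt_le_two hk hN⟩
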